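/- Let $N\ge 1$ and, for $x\in[0,1]$, let $H_x$ be a Hermitian $N\times N$ matrix depending on $x$ in a $C^2$ way, with non-degenerate spectrum: $H_x=\sum_{a=0}^{N-1}E_a(x)P_a(x)$, $E_0(x)<E_1(x)<\dots<E_{N-1}(x)$, where the $P_a(x)$ are mutually orthogonal rank-one orthogonal projections with $\sum_aP_a(x)=\mathbb 1$. Let $\gamma:[0,1]\to[0,\infty)$ be $C^1$ and let $\mathcal L_x(\rho)=-i[H_x,\rho]-\gamma(x)\sum_{a\ne b}P_a(x)\,\rho\,P_b(x)$ be the uniform dephasing Lindbladian. Define the mass $$M(x)=\sum_{a\ne 0}\frac{\gamma(x)\,\operatorname{tr}\bigl(P_a(x)\,P_0'(x)^2\bigr)}{(E_0(x)-E_a(x))^2+\gamma(x)^2},\qquad x\in[0,1],$$ where the prime is the derivative with respect to $x$; thus $M$ is determined by $H$ and $\gamma$ alone and does not depend on the choice of the schedule (parametrisation) below. Then $M(x)\ge 0$ for all $x\in[0,1]$. Moreover, for every $C^2$ schedule $q:[0,1]\to[0,1]$ (in particular those with $q(0)=0$, $q(1)=1$) there is a constant $C$ such that for every $\varepsilon>0$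 the solution $\rho$ of $\varepsilon\dot\rho(s)=\mathcal L_{q(s)}(\rho(s))$, $0\le s\le 1$, with initial state $\rho(0)=P_0(q(0))$ satisfies $$\Bigl|\,1-\operatorname{tr}\bigl[P_0(q(1))\,\rho(1)\bigr]-2\varepsilon\int_0^1M(q(u))\,\dot q(u)^2\,du\,\Bigr|\le C\varepsilon^2 .$$ -/

import Mathlib

open Set

noncomputable section

/-- `H = ∑ₐ Eₐ Pₐ` is the spectral decomposition of a Hermitian `N × N` matrix `H` with
non-degenerate spectrum `E₀ < E₁ < ⋯ < E_{N-1}`: the `Pₐ` are mutually orthogonal, Hermitian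
projections of rank one (for a projection, trace one) that sum to the identity. -/
structure IsNondegenerateSpectralDecomposition {N : ℕ} (H : Matrix (Fin N) (Fin N) ℂ)
    (E : Fin N → ℝ) (P : Fin N → Matrix (Fin N) (Fin N) ℂ) : Prop where
  strictMono : StrictMono E
  isHermitian : ∀ a, (P a).IsHermitian
  idempotent : ∀ a, P a * P a = P a
  orthogonal : ∀ a b, a ≠ b → P a * P b = 0
  trace_eq_one : ∀ a, (P a).trace = 1
  sum_eq_one : ∑ a, P a = 1
  eq_sum : H = ∑ a, (E a : ℂ) • P a

/-- The uniform dephasing Lindbladian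
`ρ ↦ -i [H, ρ] - γ ∑_{a ≠ b} Pₐ ρ P_b`. -/
def dephasingLindbladian {N : ℕ} (H : Matrix (Fin N) (Fin N) ℂ)
    (P : Fin N → Matrix (Fin N) (Fin N) ℂ) (γ : ℝ) (ρ : Matrix (Fin N) (Fin N) ℂ) :
    Matrix (Fin N) (Fin N) ℂ :=
  -(Complex.I • (H * ρ - ρ * H))
    - (γ : ℂ) • ∑ p ∈ (Finset.univ : Finset (Fin N)).offDiag, P p.1 * ρ * P p.2

/-- `ρ` solves, on `0 ≤ s ≤ 1`, the master equation `ε dρ/ds = L_{q(s)} ρ(s)`, `ε > 0`, with the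
initial condition that `ρ(0)` is the ground state of the Hamiltonian at the start of the
schedule. -/
structure IsDephasingEvolution {N : ℕ} [NeZero N] (H : ℝ → Matrix (Fin N) (Fin N) ℂ)
    (P : Fin N → ℝ → Matrix (Fin N) (Fin N) ℂ) (γ : ℝ → ℝ) (q : ℝ → ℝ) (ε : ℝ)
    (ρ : ℝ → Matrix (Fin N) (Fin N) ℂ) : Prop where
  initial : ρ 0 = P 0 (q 0)
  master : ∀ s ∈ Icc (0 : ℝ) 1, HasDerivWithinAt ρ
    (ε⁻¹ • dephasingLindbladian (H (q s)) (fun a => P a (q s)) (γ (q s)) (ρ s))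
    (Icc (0 : ℝ) 1) s

/-- The final tunneling probability `1 - tr (P₀ ρ(1))`, where `P₀` is the ground state projection
at the end of the schedule. (The trace is real, both matrices being Hermitian.) -/
def tunnelingProbability {N : ℕ} [NeZero N] (P : Fin N → ℝ → Matrix (Fin N) (Fin N) ℂ)
    (q : ℝ → ℝ) (ρ : ℝ → Matrix (Fin N) (Fin N) ℂ) : ℝ :=
  1 - (P 0 (q 1) * ρ 1).trace.re

/-- The mass
`M(x) = ∑_{a ≠ 0} γ(x) tr (Pₐ(x) P₀'(x)²) / ((E₀(x) - Eₐ(x))² + γ(x)²)`, the prime being the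
derivative with respect to `x ∈ [0,1]` (one-sided at the end points). It is a function of the path
of Hamiltonians and of the rate only; no schedule enters. -/
def tunnelingMass {N : ℕ} [NeZero N] (E : Fin N → ℝ → ℝ)
    (P : Fin N → ℝ → Matrix (Fin N) (Fin N) ℂ) (γ : ℝ → ℝ) (x : ℝ) : ℝ :=
  ∑ a ∈ Finset.univ.erase (0 : Fin N),
    γ x * (P a x * derivWithin (P 0) (Icc (0 : ℝ) 1) x ^ 2).trace.re
      / ((E 0 x - E a x) ^ 2 + γ x ^ 2)

end

/-!
The proof is a first order adiabatic expansion in which the Lindbladian `L_x` only has to be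
inverted on the blocks `Pₐ · P₀` and `P₀ · Pₐ`, `a ≠ 0`.

* `L_x` is diagonal in the blocks `Pₐ ρ P_b`, with eigenvalue `-i (Eₐ - E_b) - γ [a ≠ b]`
  (`proj_mul_lindbladian_mul_proj`). Hence it is dissipative for the Hilbert-Schmidt inner product,
  its kernel contains `P₀`, it conserves `tr (P₀ ρ)`, and it is invertible on off-diagonal blocks
  because the spectrum is simple, whether or not `γ` vanishes.
* Differentiating `P₀² = P₀` shows that `Ṗ₀` only has blocks between `P₀` and its complement. So
  there are explicit solutions of `L Y = Ṗ₀` and of the adjoint equation `L* X = Ṗ₀`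
  (`lindbladian_groundCorrector`, `trace_groundCorrector_mul_lindbladian`).
* By dissipativity, `ρ - P₀ - ε Y` is of order `ε`, and so is `ρ - P₀`
  (`exists_norm_sub_le_of_dissipative`). As
  `d/ds tr (P₀ ρ) = tr (Ṗ₀ ρ) = tr (X L ρ) = ε tr (X ρ̇)`, integrating by parts and replacing `ρ`
  by `P₀` costs `O(ε²)` and leaves `ε ∫ tr (X Ṗ₀)` (`exists_abs_overlap_sub_le`). All bounds hold
  for every `ε > 0`, not only for small `ε`.
* The real part of the inverse eigenvalue is `-γ / ((E₀ - Eₐ)² + γ²)`, which gives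
  `tr (X Ṗ₀) = -2 M q̇²` (`re_trace_groundCorrector_mul_derivWithin`).

The argument needs `X` and `Y` to be `C¹`, hence `P₀` to be `C²` and the other spectral data to be
`C¹`, whereas only the entries of `H` are assumed to be regular. The regularity of the eigenvalues
comes from the implicit function theorem applied to the characteristic polynomial
(`contDiffOn_eigenvalue`), that of the projections from Lagrange interpolation
(`contDiffOn_projection`).
-/

noncomputable section

open scoped InnerProductSpace Topology ComplexConjugate

/-! ### The blocks of the dephasing Lindbladian -/

/-- The eigenvalue of the dephasing Lindbladian on the block `Pₐ ρ P_b`. -/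
def dephasingEigenvalue {N : ℕ} (E : Fin N → ℝ) (γ : ℝ) (a b : Fin N) : ℂ :=
  -(Complex.I * ((E a : ℂ) - E b)) - if a = b then 0 else (γ : ℂ)

theorem dephasingEigenvalue_self {N : ℕ} (E : Fin N → ℝ) (γ : ℝ) (a : Fin N) :
    dephasingEigenvalue E γ a a = 0 := by
  simp [dephasingEigenvalue]

theorem conj_dephasingEigenvalue {N : ℕ} (E : Fin N → ℝ) (γ : ℝ) (a b : Fin N) :
    conj (dephasingEigenvalue E γ a b) = dephasingEigenvalue E γ b a := by
  by_cases h : a = b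
  · subst h; simp [dephasingEigenvalue]
  · simp [dephasingEigenvalue, h, Ne.symm h]
    ring

theorem dephasingEigenvalue_re {N : ℕ} (E : Fin N → ℝ) (γ : ℝ) {a b : Fin N} (h : a ≠ b) :
    (dephasingEigenvalue E γ a b).re = -γ := by
  simp [dephasingEigenvalue, h]

theorem dephasingEigenvalue_re_nonpos {N : ℕ} (E : Fin N → ℝ) {γ : ℝ} (hγ : 0 ≤ γ)
    (a b : Fin N) : (dephasingEigenvalue E γ a b).re ≤ 0 := by
  by_cases h : a = b
  · simp [dephasingEigenvalue, h]
  · simpa [dephasingEigenvalue_re E γ h] using hγ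

theorem dephasingEigenvalue_im {N : ℕ} (E : Fin N → ℝ) (γ : ℝ) (a b : Fin N) :
    (dephasingEigenvalue E γ a b).im = E b - E a := by
  by_cases h : a = b <;> simp [dephasingEigenvalue, h]

/-- The gap condition: the only eigenvalues that vanish are the diagonal ones. -/
theorem dephasingEigenvalue_ne_zero {N : ℕ} {E : Fin N → ℝ} (hE : StrictMono E) (γ : ℝ)
    {a b : Fin N} (h : a ≠ b) : dephasingEigenvalue E γ a b ≠ 0 := by
  intro h0
  have := dephasingEigenvalue_im E γ a b
  rw [h0, Complex.zero_im] at this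
  exact h (hE.injective (by linarith))

/-- The real part of the inverse eigenvalue is the Lorentzian that enters the mass. -/
theorem inv_dephasingEigenvalue_re {N : ℕ} (E : Fin N → ℝ) (γ : ℝ) {a b : Fin N} (h : a ≠ b) :
    ((dephasingEigenvalue E γ a b)⁻¹).re = -γ / ((E b - E a) ^ 2 + γ ^ 2) := by
  rw [Complex.inv_re, Complex.normSq_apply, dephasingEigenvalue_re E γ h, dephasingEigenvalue_im]
  ring_nf

theorem Matrix.trace_conjTranspose_mul_self_eq_sum {N : ℕ}
    (A : Matrix (Fin N) (Fin N) ℂ) :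
    (A.conjTranspose * A).trace = ((∑ i, ∑ j, ‖A i j‖ ^ 2 : ℝ) : ℂ) := by
  simp only [Matrix.trace, Matrix.diag_apply, Matrix.mul_apply, Matrix.conjTranspose_apply]
  rw [Finset.sum_comm]
  push_cast
  refine Finset.sum_congr rfl fun i _ => Finset.sum_congr rfl fun j _ => ?_
  exact Complex.conj_mul' _

namespace IsNondegenerateSpectralDecomposition

variable {N : ℕ} {H : Matrix (Fin N) (Fin N) ℂ} {E : Fin N → ℝ}
  {P : Fin N → Matrix (Fin N) (Fin N) ℂ}

theorem proj_mul_proj (S : IsNondegenerateSpectralDecomposition H E P) (a b : Fin N) :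
    P a * P b = if a = b then P a else 0 := by
  split_ifs with h
  · rw [← h, S.idempotent]
  · exact S.orthogonal a b h

theorem mul_proj (S : IsNondegenerateSpectralDecomposition H E P) (a : Fin N) :
    H * P a = (E a : ℂ) • P a := by
  conv_lhs => rw [S.eq_sum]
  simp [Finset.sum_mul, S.proj_mul_proj]

theorem proj_mul (S : IsNondegenerateSpectralDecomposition H E P) (a : Fin N) :
    P a * H = (E a : ℂ) • P a := by
  conv_lhs => rw [S.eq_sum]
  simp [Finset.mul_sum, S.proj_mul_proj]

/-- The Lindbladian is diagonal in the block decomposition of a matrix. -/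
theorem proj_mul_lindbladian_mul_proj (S : IsNondegenerateSpectralDecomposition H E P) (γ : ℝ)
    (ρ : Matrix (Fin N) (Fin N) ℂ) (a b : Fin N) :
    P a * dephasingLindbladian H P γ ρ * P b
      = dephasingEigenvalue E γ a b • (P a * ρ * P b) := by
  have h1 : P a * (H * ρ) * P b = (E a : ℂ) • (P a * ρ * P b) := by
    rw [← mul_assoc, S.proj_mul, smul_mul_assoc, smul_mul_assoc]
  have h2 : P a * (ρ * H) * P b = (E b : ℂ) • (P a * ρ * P b) := by
    rw [← mul_assoc, mul_assoc _ H, S.mul_proj, mul_smul_comm]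
  have h3 : P a * (∑ p ∈ (Finset.univ : Finset (Fin N)).offDiag, P p.1 * ρ * P p.2) * P b
      = if a = b then 0 else P a * ρ * P b := by
    have key : ∀ p : Fin N × Fin N, P a * (P p.1 * ρ * P p.2) * P b
        = if p = (a, b) then P a * ρ * P b else 0 := by
      rintro ⟨c, d⟩
      have : P a * (P c * ρ * P d) * P b = (P a * P c) * ρ * (P d * P b) := by
        simp only [mul_assoc]
      rw [this, S.proj_mul_proj, S.proj_mul_proj]
      by_cases h : a = c <;> by_cases h' : d = b <;> simp [Prod.ext_iff, h, h', Ne.symm]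
    rw [Finset.mul_sum, Finset.sum_mul, Finset.sum_congr rfl fun p _ => key p,
      Finset.sum_ite_eq']
    simp
  have : P a * dephasingLindbladian H P γ ρ * P b
      = -(Complex.I • (P a * (H * ρ) * P b - P a * (ρ * H) * P b))
        - (γ : ℂ) • (P a * (∑ p ∈ (Finset.univ : Finset (Fin N)).offDiag,
            P p.1 * ρ * P p.2) * P b) := by
    simp only [dephasingLindbladian, mul_sub, sub_mul, mul_neg, neg_mul, mul_smul_comm,
      smul_mul_assoc]
  rw [this, h1, h2, h3, dephasingEigenvalue, ← sub_smul, smul_smul]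
  by_cases h : a = b
  · simp [h]
  · simp only [h, if_false, sub_smul, neg_smul]

theorem eq_sum_blocks (S : IsNondegenerateSpectralDecomposition H E P)
    (A : Matrix (Fin N) (Fin N) ℂ) : A = ∑ a, ∑ b, P a * A * P b := by
  simp_rw [← Finset.mul_sum, S.sum_eq_one, mul_one, ← Finset.sum_mul, S.sum_eq_one, one_mul]

theorem eq_of_blocks_eq (S : IsNondegenerateSpectralDecomposition H E P)
    {A B : Matrix (Fin N) (Fin N) ℂ} (h : ∀ a b, P a * A * P b = P a * B * P b) : A = B := by
  rw [S.eq_sum_blocks A, S.eq_sum_blocks B]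
  simp_rw [h]

theorem block_block (S : IsNondegenerateSpectralDecomposition H E P)
    (A : Matrix (Fin N) (Fin N) ℂ) (a b c d : Fin N) :
    P c * (P a * A * P b) * P d = if c = a ∧ b = d then P a * A * P b else 0 := by
  have : P c * (P a * A * P b) * P d = (P c * P a) * A * (P b * P d) := by simp only [mul_assoc]
  rw [this, S.proj_mul_proj, S.proj_mul_proj]
  by_cases h : c = a <;> by_cases h' : b = d <;> simp [h, h']

theorem lindbladian_block (S : IsNondegenerateSpectralDecomposition H E P) (γ : ℝ)
    (A : Matrix (Fin N) (Fin N) ℂ) (a b : Fin N) :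
    dephasingLindbladian H P γ (P a * A * P b)
      = dephasingEigenvalue E γ a b • (P a * A * P b) := by
  refine S.eq_of_blocks_eq fun c d => ?_
  rw [S.proj_mul_lindbladian_mul_proj, mul_smul_comm, smul_mul_assoc, S.block_block]
  split_ifs with h
  · rw [h.1, h.2]
  · simp

theorem lindbladian_proj (S : IsNondegenerateSpectralDecomposition H E P) (γ : ℝ) (a : Fin N) :
    dephasingLindbladian H P γ (P a) = 0 := by
  have := S.lindbladian_block γ 1 a a
  rwa [mul_one, S.idempotent, dephasingEigenvalue_self, zero_smul] at this

theorem trace_block_mul (S : IsNondegenerateSpectralDecomposition H E P) (γ : ℝ)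
    (A ρ : Matrix (Fin N) (Fin N) ℂ) (a b : Fin N) :
    (P a * A * P b * dephasingLindbladian H P γ ρ).trace
      = dephasingEigenvalue E γ b a * (P a * A * P b * ρ).trace := by
  have key : ∀ B : Matrix (Fin N) (Fin N) ℂ, (P a * A * P b * B).trace
      = (A * (P b * B * P a)).trace := fun B => by
    rw [mul_assoc, mul_assoc, Matrix.trace_mul_comm (P a)]
    simp only [mul_assoc]
  rw [key, key, S.proj_mul_lindbladian_mul_proj, mul_smul_comm, Matrix.trace_smul, smul_eq_mul]

/-- The populations are conserved by the Lindbladian. -/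
theorem trace_proj_mul_lindbladian (S : IsNondegenerateSpectralDecomposition H E P) (γ : ℝ)
    (ρ : Matrix (Fin N) (Fin N) ℂ) (a : Fin N) :
    (P a * dephasingLindbladian H P γ ρ).trace = 0 := by
  have := S.trace_block_mul γ 1 ρ a a
  rwa [mul_one, S.idempotent, dephasingEigenvalue_self, zero_mul] at this

theorem trace_conjTranspose_mul_block (S : IsNondegenerateSpectralDecomposition H E P)
    (ρ : Matrix (Fin N) (Fin N) ℂ) (a b : Fin N) :
    (ρ.conjTranspose * (P a * ρ * P b)).trace
      = ((P a * ρ * P b).conjTranspose * (P a * ρ * P b)).trace := by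
  rw [Matrix.conjTranspose_mul, Matrix.conjTranspose_mul, (S.isHermitian a).eq,
    (S.isHermitian b).eq, mul_assoc (P b), Matrix.trace_mul_comm (P b)]
  have h : ρ.conjTranspose * P a * (P a * ρ * P b) * P b
      = ρ.conjTranspose * ((P a * P a) * ρ * (P b * P b)) := by simp only [mul_assoc]
  rw [h, S.idempotent, S.idempotent]

/-- The Lindbladian is dissipative for the Hilbert-Schmidt inner product. -/
theorem re_trace_conjTranspose_mul_lindbladian_nonpos
    (S : IsNondegenerateSpectralDecomposition H E P) {γ : ℝ} (hγ : 0 ≤ γ)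
    (ρ : Matrix (Fin N) (Fin N) ℂ) :
    (ρ.conjTranspose * dephasingLindbladian H P γ ρ).trace.re ≤ 0 := by
  rw [S.eq_sum_blocks (dephasingLindbladian H P γ ρ)]
  simp_rw [S.proj_mul_lindbladian_mul_proj, Finset.mul_sum, Matrix.trace_sum, Complex.re_sum,
    mul_smul_comm, Matrix.trace_smul, S.trace_conjTranspose_mul_block,
    Matrix.trace_conjTranspose_mul_self_eq_sum, smul_eq_mul, Complex.re_mul_ofReal]
  exact Finset.sum_nonpos fun a _ => Finset.sum_nonpos fun b _ =>
    mul_nonpos_of_nonpos_of_nonneg (dephasingEigenvalue_re_nonpos E hγ a b) (by positivity)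

theorem re_trace_proj_mul_sq_nonneg (S : IsNondegenerateSpectralDecomposition H E P)
    {D : Matrix (Fin N) (Fin N) ℂ} (hD : D.IsHermitian) (a : Fin N) :
    0 ≤ (P a * D ^ 2).trace.re := by
  have : (P a * D ^ 2).trace = ((D * P a).conjTranspose * (D * P a)).trace := by
    rw [Matrix.conjTranspose_mul, hD.eq, (S.isHermitian a).eq, ← mul_assoc,
      Matrix.trace_mul_comm _ (P a), sq, ← mul_assoc, ← mul_assoc, ← mul_assoc, S.idempotent]
  rw [this, Matrix.trace_conjTranspose_mul_self_eq_sum, Complex.ofReal_re]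
  positivity

end IsNondegenerateSpectralDecomposition

theorem dephasingLindbladian_smul {N : ℕ} (H : Matrix (Fin N) (Fin N) ℂ)
    (P : Fin N → Matrix (Fin N) (Fin N) ℂ) (γ : ℝ) (c : ℂ) (A : Matrix (Fin N) (Fin N) ℂ) :
    dephasingLindbladian H P γ (c • A) = c • dephasingLindbladian H P γ A := by
  simp only [dephasingLindbladian, mul_smul_comm, smul_mul_assoc, ← Finset.smul_sum, smul_sub,
    smul_neg]
  simp only [smul_comm c]

/-- The dephasing Lindbladian as a real linear map. -/
def dephasingLinearMap {N : ℕ} (H : Matrix (Fin N) (Fin N) ℂ)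
    (P : Fin N → Matrix (Fin N) (Fin N) ℂ) (γ : ℝ) :
    Matrix (Fin N) (Fin N) ℂ →ₗ[ℝ] Matrix (Fin N) (Fin N) ℂ where
  toFun := dephasingLindbladian H P γ
  map_add' A B := by
    simp only [dephasingLindbladian, mul_add, add_mul, Finset.sum_add_distrib, smul_add, smul_sub]
    abel
  map_smul' c A := dephasingLindbladian_smul H P γ c A

/-! ### Off-diagonal perturbations of the ground state projection -/

/-- The matrix with the off-diagonal blocks `cₐ Pₐ D P₀` and `c̄ₐ P₀ D Pₐ`, `a ≠ 0`. For
suitable `c` it solves the equation `L Y = D`, respectively its adjoint. -/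
def groundCorrector {N : ℕ} [NeZero N] (P : Fin N → Matrix (Fin N) (Fin N) ℂ) (c : Fin N → ℂ)
    (D : Matrix (Fin N) (Fin N) ℂ) : Matrix (Fin N) (Fin N) ℂ :=
  ∑ a ∈ Finset.univ.erase (0 : Fin N), (c a • (P a * D * P 0) + conj (c a) • (P 0 * D * P a))

namespace IsNondegenerateSpectralDecomposition

variable {N : ℕ} [NeZero N] {H : Matrix (Fin N) (Fin N) ℂ} {E : Fin N → ℝ}
  {P : Fin N → Matrix (Fin N) (Fin N) ℂ} {D : Matrix (Fin N) (Fin N) ℂ}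

theorem proj_mul_tangent (S : IsNondegenerateSpectralDecomposition H E P)
    (hD : D * P 0 + P 0 * D = D) {a : Fin N} (ha : a ≠ 0) : P a * D = P a * D * P 0 := by
  conv_lhs => rw [← hD, mul_add, ← mul_assoc, ← mul_assoc, S.orthogonal a 0 ha]
  simp

theorem ground_tangent_ground (S : IsNondegenerateSpectralDecomposition H E P)
    (hD : D * P 0 + P 0 * D = D) : P 0 * D * P 0 = 0 := by
  have h := congrArg (fun A => P 0 * A * P 0) hD
  have e1 : P 0 * (D * P 0 + P 0 * D) * P 0
      = P 0 * D * (P 0 * P 0) + (P 0 * P 0) * D * P 0 := by noncomm_ring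
  simp only [e1, S.idempotent] at h
  simpa using h

/-- A tangent vector to the projections at `P₀` couples only `P₀` to its complement. -/
theorem groundCorrector_one (S : IsNondegenerateSpectralDecomposition H E P)
    (hD : D * P 0 + P 0 * D = D) : groundCorrector P 1 D = D := by
  have h1 : ∑ a ∈ Finset.univ.erase (0 : Fin N), P a = 1 - P 0 := by
    rw [← S.sum_eq_one, ← Finset.add_sum_erase _ _ (Finset.mem_univ (0 : Fin N))]
    abel
  simp only [groundCorrector, Pi.one_apply, one_smul, map_one, Finset.sum_add_distrib,
    ← Finset.sum_mul, ← Finset.mul_sum, h1]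
  simp only [sub_mul, mul_sub, one_mul, mul_one, S.ground_tangent_ground hD, sub_zero, hD]

theorem lindbladian_groundCorrector (S : IsNondegenerateSpectralDecomposition H E P)
    (hD : D * P 0 + P 0 * D = D) (γ : ℝ) :
    dephasingLindbladian H P γ
      (groundCorrector P (fun a => (dephasingEigenvalue E γ a 0)⁻¹) D) = D := by
  have h0 := S.groundCorrector_one hD
  conv_rhs => rw [← h0]
  change dephasingLinearMap H P γ _ = _
  rw [groundCorrector, map_sum, groundCorrector]
  refine Finset.sum_congr rfl fun a ha => ?_
  have ha : a ≠ 0 := Finset.ne_of_mem_erase ha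
  rw [map_add]
  change dephasingLindbladian H P γ _ + dephasingLindbladian H P γ _ = _
  rw [dephasingLindbladian_smul, dephasingLindbladian_smul, S.lindbladian_block,
    S.lindbladian_block, smul_smul, smul_smul, map_inv₀, conj_dephasingEigenvalue,
    inv_mul_cancel₀ (dephasingEigenvalue_ne_zero S.strictMono γ ha),
    inv_mul_cancel₀ (dephasingEigenvalue_ne_zero S.strictMono γ ha.symm)]
  simp

theorem trace_groundCorrector_mul_lindbladian (S : IsNondegenerateSpectralDecomposition H E P)
    (hD : D * P 0 + P 0 * D = D) (γ : ℝ) (ρ : Matrix (Fin N) (Fin N) ℂ) :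
    (groundCorrector P (fun a => (dephasingEigenvalue E γ 0 a)⁻¹) D
      * dephasingLindbladian H P γ ρ).trace = (D * ρ).trace := by
  conv_rhs => rw [← S.groundCorrector_one hD]
  simp only [groundCorrector, Finset.sum_mul, Matrix.trace_sum]
  refine Finset.sum_congr rfl fun a ha => ?_
  have ha : a ≠ 0 := Finset.ne_of_mem_erase ha
  simp only [add_mul, smul_mul_assoc, Matrix.trace_add, Matrix.trace_smul, smul_eq_mul,
    S.trace_block_mul, map_inv₀, conj_dephasingEigenvalue]
  rw [inv_mul_cancel_left₀ (dephasingEigenvalue_ne_zero S.strictMono γ ha),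
    inv_mul_cancel_left₀ (dephasingEigenvalue_ne_zero S.strictMono γ ha.symm)]
  simp

theorem trace_groundCorrector_mul_ground (S : IsNondegenerateSpectralDecomposition H E P)
    (c : Fin N → ℂ) : (groundCorrector P c D * P 0).trace = 0 := by
  simp only [groundCorrector, Finset.sum_mul, Matrix.trace_sum]
  refine Finset.sum_eq_zero fun a ha => ?_
  have ha : a ≠ 0 := Finset.ne_of_mem_erase ha
  rw [add_mul, smul_mul_assoc, smul_mul_assoc, mul_assoc (P 0 * D), S.orthogonal a 0 ha, mul_assoc,
    S.idempotent, mul_assoc, Matrix.trace_add, Matrix.trace_smul, Matrix.trace_mul_comm, mul_assoc,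
    S.orthogonal 0 a ha.symm]
  simp

theorem re_trace_groundCorrector_mul (S : IsNondegenerateSpectralDecomposition H E P)
    (hD : D * P 0 + P 0 * D = D) (c : Fin N → ℂ) :
    (groundCorrector P c D * D).trace.re
      = ∑ a ∈ Finset.univ.erase (0 : Fin N), 2 * (c a).re * (P a * D ^ 2).trace.re := by
  simp only [groundCorrector, Finset.sum_mul, Matrix.trace_sum, Complex.re_sum]
  refine Finset.sum_congr rfl fun a ha => ?_
  have ha : a ≠ 0 := Finset.ne_of_mem_erase ha
  have h1 : P a * D * P 0 * D = P a * D ^ 2 := by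
    rw [← S.proj_mul_tangent hD ha, sq, mul_assoc]
  have h2 : (P 0 * D * P a * D).trace = (P a * D ^ 2).trace := by
    rw [← h1, mul_assoc, Matrix.trace_mul_comm, mul_assoc (P a * D)]
  rw [add_mul, smul_mul_assoc, smul_mul_assoc, Matrix.trace_add, Matrix.trace_smul,
    Matrix.trace_smul, h1, h2, smul_eq_mul, smul_eq_mul, ← add_mul, Complex.add_conj,
    Complex.re_ofReal_mul]

theorem isHermitian_groundCorrector (S : IsNondegenerateSpectralDecomposition H E P)
    (hD : D.IsHermitian) (c : Fin N → ℂ) : (groundCorrector P c D).IsHermitian := by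
  unfold Matrix.IsHermitian groundCorrector
  rw [Matrix.conjTranspose_sum]
  refine Finset.sum_congr rfl fun a _ => ?_
  rw [Matrix.conjTranspose_add, Matrix.conjTranspose_smul, Matrix.conjTranspose_smul]
  simp only [Matrix.conjTranspose_mul, hD.eq, (S.isHermitian _).eq, ← mul_assoc]
  rw [add_comm]
  simp

end IsNondegenerateSpectralDecomposition

/-! ### Adiabatic expansion for dissipative evolutions -/

section Adiabatic

variable {V : Type*} [NormedAddCommGroup V] [InnerProductSpace ℝ V]

/-- The energy estimate: the difference of the evolution and the corrected ansatz stays of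
order `ε`, because `L` is dissipative. -/
theorem norm_sq_le_of_dissipative {L : ℝ → V →ₗ[ℝ] V} {ε K : ℝ} (hε : 0 < ε)
    (hL : ∀ s ∈ Icc (0 : ℝ) 1, ∀ v, ⟪v, L s v⟫_ℝ ≤ 0) {r f : ℝ → V}
    (hr : ∀ s ∈ Icc (0 : ℝ) 1,
      HasDerivWithinAt r (ε⁻¹ • L s (r s) - ε • f s) (Icc (0 : ℝ) 1) s)
    (hf : ∀ s ∈ Icc (0 : ℝ) 1, ‖f s‖ ≤ K) :
    ∀ s ∈ Icc (0 : ℝ) 1, ‖r s‖ ^ 2 ≤ Real.exp 1 * (‖r 0‖ ^ 2 + ε ^ 2 * K ^ 2) := by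
  -- Gronwall: the forcing is absorbed by `2 ε ‖r‖ K ≤ ‖r‖² + ε² K²`, so `g` is antitone.
  set g : ℝ → ℝ := fun s => Real.exp (-s) * ‖r s‖ ^ 2 - ε ^ 2 * K ^ 2 * s with hg
  have hd : ∀ s ∈ Icc (0 : ℝ) 1, HasDerivWithinAt g
      (Real.exp (-s) * (2 * ⟪r s, ε⁻¹ • L s (r s) - ε • f s⟫_ℝ - ‖r s‖ ^ 2) - ε ^ 2 * K ^ 2)
      (Icc (0 : ℝ) 1) s := fun s hs => by
    have h1 := (hr s hs).norm_sq
    have h2 : HasDerivWithinAt (fun s : ℝ => Real.exp (-s)) (Real.exp (-s) * (-1))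
        (Icc (0 : ℝ) 1) s := ((hasDerivAt_id s).neg.exp).hasDerivWithinAt
    have h3 := (h2.mul h1).sub (((hasDerivAt_id s).const_mul (ε ^ 2 * K ^ 2)).hasDerivWithinAt)
    convert! h3 using 1
    ring
  have hanti : AntitoneOn g (Icc (0 : ℝ) 1) := by
    refine antitoneOn_of_hasDerivWithinAt_nonpos (convex_Icc 0 1)
      (fun s hs => (hd s hs).continuousWithinAt)
      (fun s hs => (hd s (interior_subset hs)).mono interior_subset) fun s hs => ?_
    have hs := interior_subset hs
    have e1 : 2 * ⟪r s, ε⁻¹ • L s (r s) - ε • f s⟫_ℝ - ‖r s‖ ^ 2 ≤ ε ^ 2 * K ^ 2 := by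
      rw [inner_sub_right, inner_smul_right, inner_smul_right]
      have a1 : ε⁻¹ * ⟪r s, L s (r s)⟫_ℝ ≤ 0 :=
        mul_nonpos_of_nonneg_of_nonpos (by positivity) (hL s hs _)
      have a2 : -⟪r s, f s⟫_ℝ ≤ ‖r s‖ * ‖f s‖ := by
        rw [← inner_neg_right, ← norm_neg (f s)]; exact real_inner_le_norm _ _
      have a3 : ‖r s‖ * ‖f s‖ ≤ ‖r s‖ * K := by gcongr; exact hf s hs
      nlinarith [sq_nonneg (‖r s‖ - ε * K)]
    have e2 : Real.exp (-s) ≤ 1 := Real.exp_le_one_iff.2 (by linarith [hs.1])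
    nlinarith [Real.exp_pos (-s), mul_le_mul_of_nonneg_left e1 (Real.exp_pos (-s)).le,
      mul_le_mul_of_nonneg_right e2 (by positivity : 0 ≤ ε ^ 2 * K ^ 2)]
  intro s hs
  have h := hanti (left_mem_Icc.2 zero_le_one) hs hs.1
  simp only [hg, neg_zero, Real.exp_zero, one_mul, mul_zero, sub_zero] at h
  have h4 : Real.exp (-s) * ‖r s‖ ^ 2 ≤ ‖r 0‖ ^ 2 + ε ^ 2 * K ^ 2 := by
    nlinarith [hs.2, (by positivity : 0 ≤ ε ^ 2 * K ^ 2)]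
  calc ‖r s‖ ^ 2 = Real.exp s * (Real.exp (-s) * ‖r s‖ ^ 2) := by
        rw [← mul_assoc, ← Real.exp_add]; simp
    _ ≤ Real.exp 1 * (‖r 0‖ ^ 2 + ε ^ 2 * K ^ 2) := by
        gcongr
        exact hs.2

/-- First order adiabatic theorem: an evolution generated by `ε⁻¹ L` and started in the kernel of
`L` stays `ε`-close to the path `p` in the kernel, provided `p'` lies in the range of `L`. -/
theorem exists_norm_sub_le_of_dissipative {L : ℝ → V →ₗ[ℝ] V}
    (hL : ∀ s ∈ Icc (0 : ℝ) 1, ∀ v, ⟪v, L s v⟫_ℝ ≤ 0) {p p' Y Y' : ℝ → V}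
    (hp : ∀ s ∈ Icc (0 : ℝ) 1, HasDerivWithinAt p (p' s) (Icc (0 : ℝ) 1) s)
    (hLp : ∀ s ∈ Icc (0 : ℝ) 1, L s (p s) = 0)
    (hY : ∀ s ∈ Icc (0 : ℝ) 1, HasDerivWithinAt Y (Y' s) (Icc (0 : ℝ) 1) s)
    (hY' : ContinuousOn Y' (Icc (0 : ℝ) 1))
    (hLY : ∀ s ∈ Icc (0 : ℝ) 1, L s (Y s) = p' s) :
    ∃ B : ℝ, ∀ ε : ℝ, 0 < ε → ∀ ρ : ℝ → V, ρ 0 = p 0 →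
      (∀ s ∈ Icc (0 : ℝ) 1, HasDerivWithinAt ρ (ε⁻¹ • L s (ρ s)) (Icc (0 : ℝ) 1) s) →
      ∀ s ∈ Icc (0 : ℝ) 1, ‖ρ s - p s‖ ≤ B * ε := by
  obtain ⟨K, hK⟩ := isCompact_Icc.exists_bound_of_continuousOn hY'
  obtain ⟨K₀, hK₀⟩ := isCompact_Icc.exists_bound_of_continuousOn
    (fun s hs => (hY s hs).continuousWithinAt : ContinuousOn Y (Icc (0 : ℝ) 1))
  refine ⟨Real.sqrt (Real.exp 1 * (‖Y 0‖ ^ 2 + K ^ 2)) + K₀, fun ε hε ρ h0 hρ s hs => ?_⟩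
  have hr : ∀ s ∈ Icc (0 : ℝ) 1, HasDerivWithinAt (fun s => ρ s - p s - ε • Y s)
      (ε⁻¹ • L s (ρ s - p s - ε • Y s) - ε • Y' s) (Icc (0 : ℝ) 1) s := fun s hs => by
    have := ((hρ s hs).sub (hp s hs)).sub ((hY s hs).const_smul ε)
    convert! this using 1
    rw [map_sub, map_sub, hLp s hs, map_smul, hLY s hs, sub_zero, smul_sub, smul_smul,
      inv_mul_cancel₀ hε.ne', one_smul]
  have h := norm_sq_le_of_dissipative hε hL hr hK s hs
  have h1 : ‖ρ s - p s - ε • Y s‖ ≤ Real.sqrt (Real.exp 1 * (‖Y 0‖ ^ 2 + K ^ 2)) * ε := by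
    refine abs_le_of_sq_le_sq' ?_ (by positivity) |>.2
    rw [mul_pow, Real.sq_sqrt (by positivity)]
    refine h.trans_eq ?_
    rw [h0, sub_self, zero_sub, norm_neg, norm_smul, Real.norm_of_nonneg hε.le]
    ring
  calc ‖ρ s - p s‖ = ‖(ρ s - p s - ε • Y s) + ε • Y s‖ := by rw [sub_add_cancel]
    _ ≤ _ := norm_add_le _ _
    _ ≤ Real.sqrt (Real.exp 1 * (‖Y 0‖ ^ 2 + K ^ 2)) * ε + ε * K₀ := by
        rw [norm_smul, Real.norm_of_nonneg hε.le]
        gcongr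
        exact hK₀ s hs
    _ = _ := by ring

/-- Second order expansion of the overlap with the instantaneous state. Besides the corrector `Y`
for the state, it uses a corrector `X` for the observable, `L* X = p'`, to integrate by parts. -/
theorem exists_abs_overlap_sub_le {L : ℝ → V →ₗ[ℝ] V}
    (hL : ∀ s ∈ Icc (0 : ℝ) 1, ∀ v, ⟪v, L s v⟫_ℝ ≤ 0) {p p' X X' Y Y' : ℝ → V}
    (hp : ∀ s ∈ Icc (0 : ℝ) 1, HasDerivWithinAt p (p' s) (Icc (0 : ℝ) 1) s)
    (hp' : ContinuousOn p' (Icc (0 : ℝ) 1))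
    (hLp : ∀ s ∈ Icc (0 : ℝ) 1, L s (p s) = 0)
    (hpL : ∀ s ∈ Icc (0 : ℝ) 1, ∀ v, ⟪p s, L s v⟫_ℝ = 0)
    (hY : ∀ s ∈ Icc (0 : ℝ) 1, HasDerivWithinAt Y (Y' s) (Icc (0 : ℝ) 1) s)
    (hY' : ContinuousOn Y' (Icc (0 : ℝ) 1))
    (hLY : ∀ s ∈ Icc (0 : ℝ) 1, L s (Y s) = p' s)
    (hX : ∀ s ∈ Icc (0 : ℝ) 1, HasDerivWithinAt X (X' s) (Icc (0 : ℝ) 1) s)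
    (hX' : ContinuousOn X' (Icc (0 : ℝ) 1))
    (hXL : ∀ s ∈ Icc (0 : ℝ) 1, ∀ v, ⟪X s, L s v⟫_ℝ = ⟪p' s, v⟫_ℝ)
    (hXp : ∀ s ∈ Icc (0 : ℝ) 1, ⟪X s, p s⟫_ℝ = 0) :
    ∃ C : ℝ, ∀ ε : ℝ, 0 < ε → ∀ ρ : ℝ → V, ρ 0 = p 0 →
      (∀ s ∈ Icc (0 : ℝ) 1, HasDerivWithinAt ρ (ε⁻¹ • L s (ρ s)) (Icc (0 : ℝ) 1) s) →
      |⟪p 1, ρ 1⟫_ℝ - ⟪p 0, p 0⟫_ℝ - ε * ∫ u in (0 : ℝ)..1, ⟪X u, p' u⟫_ℝ| ≤ C * ε ^ 2 := by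
  obtain ⟨B, hB⟩ := exists_norm_sub_le_of_dissipative hL hp hLp hY hY' hLY
  obtain ⟨K, hK⟩ := isCompact_Icc.exists_bound_of_continuousOn hX'
  have i0 : (0 : ℝ) ∈ Icc (0 : ℝ) 1 := left_mem_Icc.2 zero_le_one
  have i1 : (1 : ℝ) ∈ Icc (0 : ℝ) 1 := right_mem_Icc.2 zero_le_one
  refine ⟨K * B + ‖X 1‖ * B, fun ε hε ρ h0 hρ => ?_⟩
  have hXc : ContinuousOn X (Icc (0 : ℝ) 1) := fun s hs => (hX s hs).continuousWithinAt
  have hm : ContinuousOn (fun u => ⟪X u, p' u⟫_ℝ) (Icc (0 : ℝ) 1) := hXc.inner hp'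
  have hint : ∀ s ∈ Icc (0 : ℝ) 1, HasDerivWithinAt (fun s => ∫ u in (0 : ℝ)..s, ⟪X u, p' u⟫_ℝ)
      ⟪X s, p' s⟫_ℝ (Icc (0 : ℝ) 1) s := fun s hs => by
    have : Fact (s ∈ Icc (0 : ℝ) 1) := ⟨hs⟩
    refine intervalIntegral.integral_hasDerivWithinAt_right
      ((hm.mono (uIcc_subset_Icc i0 hs)).intervalIntegrable)
      (hm.stronglyMeasurableAtFilter_nhdsWithin measurableSet_Icc s) (hm s hs)
  -- The constraint `⟪X, p⟫ = 0` turns `⟪X', p⟫` into `-⟪X, p'⟫`.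
  have hXp' : ∀ s ∈ Icc (0 : ℝ) 1, ⟪X s, p' s⟫_ℝ + ⟪X' s, p s⟫_ℝ = 0 := fun s hs => by
    have h1 := (hX s hs).inner ℝ (hp s hs)
    have h2 : HasDerivWithinAt (fun s => ⟪X s, p s⟫_ℝ) 0 (Icc (0 : ℝ) 1) s :=
      (hasDerivWithinAt_const s _ (0 : ℝ)).congr (fun t ht => hXp t ht) (hXp s hs)
    exact (uniqueDiffOn_Icc zero_lt_one s hs).eq_deriv _ h1 h2
  -- The terms of order `1` in `g'` cancel, which leaves one of order `ε ‖ρ - p‖`.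
  set g : ℝ → ℝ := fun s => ⟪p s, ρ s⟫_ℝ - ε * ⟪X s, ρ s⟫_ℝ
    - ε * ∫ u in (0 : ℝ)..s, ⟪X u, p' u⟫_ℝ with hg
  have hgd : ∀ s ∈ Icc (0 : ℝ) 1,
      HasDerivWithinAt g (-(ε * ⟪X' s, ρ s - p s⟫_ℝ)) (Icc (0 : ℝ) 1) s := fun s hs => by
    have := (((hp s hs).inner ℝ (hρ s hs)).sub
      (((hX s hs).inner ℝ (hρ s hs)).const_mul ε)).sub ((hint s hs).const_mul ε)
    convert! this using 1
    rw [inner_smul_right, inner_smul_right, hpL s hs, hXL s hs, inner_sub_right, mul_add,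
      mul_inv_cancel_left₀ hε.ne']
    linear_combination ε * hXp' s hs
  have hgb : ∀ s ∈ Ico (0 : ℝ) 1, ‖-(ε * ⟪X' s, ρ s - p s⟫_ℝ)‖ ≤ K * B * ε ^ 2 := fun s hs => by
    have hs := Ico_subset_Icc_self hs
    have b1 := hK s hs
    have b2 := hB ε hε ρ h0 hρ s hs
    rw [norm_neg, norm_mul, Real.norm_of_nonneg hε.le]
    calc ε * ‖⟪X' s, ρ s - p s⟫_ℝ‖ ≤ ε * (‖X' s‖ * ‖ρ s - p s‖) := by
          gcongr; exact norm_inner_le_norm _ _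
      _ ≤ ε * (K * (B * ε)) := by gcongr; exact (norm_nonneg _).trans b1
      _ = _ := by ring
  have hmv := norm_image_sub_le_of_norm_deriv_le_segment' hgd hgb 1 i1
  have hg0 : g 0 = ⟪p 0, p 0⟫_ℝ := by simp [hg, h0, hXp 0 i0]
  have hX1 : ‖⟪X 1, ρ 1⟫_ℝ‖ ≤ ‖X 1‖ * (B * ε) := by
    have : ⟪X 1, ρ 1⟫_ℝ = ⟪X 1, ρ 1 - p 1⟫_ℝ := by rw [inner_sub_right, hXp 1 i1, sub_zero]
    rw [this]
    refine (norm_inner_le_norm _ _).trans ?_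
    gcongr
    exact hB ε hε ρ h0 hρ 1 i1
  rw [hg0, sub_zero, mul_one] at hmv
  have : ⟪p 1, ρ 1⟫_ℝ - ⟪p 0, p 0⟫_ℝ - ε * ∫ u in (0 : ℝ)..1, ⟪X u, p' u⟫_ℝ
      = (g 1 - ⟪p 0, p 0⟫_ℝ) + ε * ⟪X 1, ρ 1⟫_ℝ := by simp only [hg]; ring
  rw [this]
  refine (abs_add_le _ _).trans ?_
  rw [abs_mul, abs_of_pos hε]
  have h5 := mul_le_mul_of_nonneg_left hX1 hε.le
  rw [Real.norm_eq_abs] at hmv h5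
  linarith

end Adiabatic

/-! ### Smoothness of the spectral data -/

-- The topology of the Frobenius norm unfolds to the entrywise one, with respect to which
-- derivatives of matrix paths are taken in the definitions of the evolution and of the mass.
attribute [local instance] Matrix.frobeniusNormedRing Matrix.frobeniusNormedAlgebra
  Matrix.frobeniusNormedSpace

theorem contDiff_matrix_entry {N : ℕ} {n : WithTop ℕ∞} (i j : Fin N) :
    ContDiff ℝ n fun A : Matrix (Fin N) (Fin N) ℂ => A i j :=
  (LinearMap.toContinuousLinearMap
    (Matrix.entryLinearMap ℝ ℂ i j : Matrix (Fin N) (Fin N) ℂ →ₗ[ℝ] ℂ)).contDiff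

theorem ContDiffOn.matrix_of_entries {N : ℕ} {n : WithTop ℕ∞} {s : Set ℝ}
    {A : ℝ → Matrix (Fin N) (Fin N) ℂ} (h : ∀ i j, ContDiffOn ℝ n (fun x => A x i j) s) :
    ContDiffOn ℝ n A s := by
  have : A = fun x => ∑ i, ∑ j, (A x i j) • Matrix.single i j (1 : ℂ) := by
    funext x
    conv_lhs => rw [Matrix.matrix_eq_sum_single (A x)]
    simp [Matrix.smul_single]
  rw [this]
  exact ContDiffOn.sum fun i _ => ContDiffOn.sum fun j _ => (h i j).smul contDiffOn_const

/-- The real part of the characteristic polynomial is a smooth function of the matrix and of the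
real spectral parameter. -/
theorem contDiff_re_det_sub {N : ℕ} {n : WithTop ℕ∞} :
    ContDiff ℝ n fun u : Matrix (Fin N) (Fin N) ℂ × ℝ =>
      (Matrix.det ((u.2 : ℂ) • (1 : Matrix (Fin N) (Fin N) ℂ) - u.1)).re := by
  refine Complex.reCLM.contDiff.comp ?_
  simp only [Matrix.det_apply]
  refine ContDiff.sum fun σ _ => ContDiff.const_smul _ (contDiff_prod fun i _ => ?_)
  simp only [Matrix.sub_apply, Matrix.smul_apply]
  exact ((Complex.ofRealCLM.contDiff.comp contDiff_snd).smul contDiff_const).sub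
    ((contDiff_matrix_entry _ _).comp contDiff_fst)

namespace IsNondegenerateSpectralDecomposition

variable {N : ℕ} {H : Matrix (Fin N) (Fin N) ℂ} {E : Fin N → ℝ}
  {P : Fin N → Matrix (Fin N) (Fin N) ℂ}

theorem proj_ne_zero (S : IsNondegenerateSpectralDecomposition H E P) (a : Fin N) : P a ≠ 0 := by
  intro h
  simpa [h] using S.trace_eq_one a

theorem charpoly_eq_prod (S : IsNondegenerateSpectralDecomposition H E P) :
    H.charpoly = ∏ b, (Polynomial.X - Polynomial.C (E b : ℂ)) := by
  have hroot : ∀ b, Polynomial.X - Polynomial.C (E b : ℂ) ∣ H.charpoly := fun b => by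
    rw [Polynomial.dvd_iff_isRoot, Polynomial.IsRoot, Matrix.eval_charpoly]
    by_contra hdet
    refine S.proj_ne_zero b ?_
    have hu : IsUnit (Matrix.scalar (Fin N) (E b : ℂ) - H) :=
      (Matrix.isUnit_iff_isUnit_det _).2 (isUnit_iff_ne_zero.2 hdet)
    refine hu.mul_left_cancel ?_
    rw [sub_mul, S.mul_proj, mul_zero, Matrix.scalar_apply, ← Matrix.smul_one_eq_diagonal,
      smul_mul_assoc, one_mul, sub_self]
  have hdvd : ∏ b, (Polynomial.X - Polynomial.C (E b : ℂ)) ∣ H.charpoly :=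
    Finset.prod_dvd_of_coprime
      (fun a _ b _ hab => Polynomial.isCoprime_X_sub_C_of_isUnit_sub
        (isUnit_iff_ne_zero.2 (sub_ne_zero.2 fun h =>
          hab (S.strictMono.injective (Complex.ofReal_injective h))))) fun b _ => hroot b
  refine Polynomial.eq_of_monic_of_dvd_of_natDegree_le
    (Polynomial.monic_prod_of_monic _ _ fun b _ => Polynomial.monic_X_sub_C _)
    H.charpoly_monic hdvd ?_
  rw [Matrix.charpoly_natDegree_eq_dim, Polynomial.natDegree_prod_of_monic _ _
    fun b _ => Polynomial.monic_X_sub_C _]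
  simp

theorem re_det_sub (S : IsNondegenerateSpectralDecomposition H E P) (t : ℝ) :
    (Matrix.det ((t : ℂ) • (1 : Matrix (Fin N) (Fin N) ℂ) - H)).re = ∏ b, (t - E b) := by
  have h : Matrix.det ((t : ℂ) • (1 : Matrix (Fin N) (Fin N) ℂ) - H)
      = ((∏ b, (t - E b) : ℝ) : ℂ) := by
    have := Matrix.eval_charpoly H (t : ℂ)
    rw [S.charpoly_eq_prod, Polynomial.eval_prod, Matrix.scalar_apply,
      ← Matrix.smul_one_eq_diagonal] at this
    rw [← this]
    simp
  rw [h, Complex.ofReal_re]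

/-- Simple eigenvalues persist: near `H` there is a smooth real root of the (real part of the)
characteristic polynomial through `E a`. -/
theorem exists_contDiffAt_root (S : IsNondegenerateSpectralDecomposition H E P) (a : Fin N) :
    ∃ ψ : Matrix (Fin N) (Fin N) ℂ → ℝ, ContDiffAt ℝ 2 ψ H ∧ ψ H = E a ∧
      ∀ᶠ A in 𝓝 H, (Matrix.det ((ψ A : ℂ) • (1 : Matrix (Fin N) (Fin N) ℂ) - A)).re = 0 := by
  set f : Matrix (Fin N) (Fin N) ℂ × ℝ → ℝ := fun u =>
    (Matrix.det ((u.2 : ℂ) • (1 : Matrix (Fin N) (Fin N) ℂ) - u.1)).re with hf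
  have hc : ContDiffAt ℝ 2 f (H, E a) := contDiff_re_det_sub.contDiffAt
  have hfd : HasFDerivAt f (fderiv ℝ f (H, E a)) (H, E a) :=
    (hc.differentiableAt (by norm_num)).hasFDerivAt
  set d : ℝ := ∏ b ∈ Finset.univ.erase a, (E a - E b) with hd
  have hd0 : d ≠ 0 := Finset.prod_ne_zero_iff.2 fun b hb =>
    sub_ne_zero.2 fun h => Finset.ne_of_mem_erase hb (S.strictMono.injective h.symm)
  -- In the spectral parameter, `f` is `∏ b, (t - E b)`, which has a simple zero at `E a`.
  have h1 : HasDerivAt (fun t : ℝ => f (H, t)) d (E a) := by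
    have e : (fun t : ℝ => f (H, t))
        = fun t => (t - E a) * ∏ b ∈ Finset.univ.erase a, (t - E b) := by
      funext t
      rw [Finset.mul_prod_erase _ (fun b => t - E b) (Finset.mem_univ a)]
      exact S.re_det_sub t
    rw [e]
    have hg : DifferentiableAt ℝ (fun t : ℝ => ∏ b ∈ Finset.univ.erase a, (t - E b)) (E a) := by
      fun_prop
    have := ((hasDerivAt_id (E a)).sub_const (E a)).mul hg.hasDerivAt
    convert! this using 1
    simp [hd]
  have h2 : HasDerivAt (fun t : ℝ => f (H, t)) (fderiv ℝ f (H, E a) (0, 1)) (E a) :=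
    hfd.comp_hasDerivAt (E a) ((hasDerivAt_const (E a) H).prodMk (hasDerivAt_id (E a)))
  have h3 : fderiv ℝ f (H, E a) (0, 1) = d := h2.unique h1
  have hinv : (fderiv ℝ f (H, E a) ∘L .inr ℝ (Matrix (Fin N) (Fin N) ℂ) ℝ).IsInvertible := by
    refine ⟨ContinuousLinearEquiv.smulLeft (Units.mk0 d hd0), ?_⟩
    ext
    simp [h3]
  refine ⟨hc.implicitFunction (by norm_num) hinv, hc.contDiffAt_implicitFunction _ hinv,
    hc.implicitFunction_apply_self _ hinv, ?_⟩
  filter_upwards [hc.eventually_apply_implicitFunction (by norm_num) hinv] with A hA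
  refine hA.trans ?_
  simp only [hf]
  rw [S.re_det_sub, Finset.prod_eq_zero (Finset.mem_univ a) (sub_self _)]

end IsNondegenerateSpectralDecomposition

section Path

variable {N : ℕ} {H : ℝ → Matrix (Fin N) (Fin N) ℂ} {E : Fin N → ℝ → ℝ}
  {P : Fin N → ℝ → Matrix (Fin N) (Fin N) ℂ} {s : Set ℝ}

/-- The ordered eigenvalues of a `C²` path of matrices with simple spectrum are `C²`: the smooth
local roots are strictly ordered near a point, so there they must be the ordered eigenvalues. -/
theorem contDiffOn_eigenvalue
    (hspec : ∀ x ∈ s, IsNondegenerateSpectralDecomposition (H x) (fun a => E a x) (fun a => P a x))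
    (hH : ContDiffOn ℝ 2 H s) (a : Fin N) : ContDiffOn ℝ 2 (E a) s := by
  intro x hx
  choose ψ hψ hψx hroot using fun a => (hspec x hx).exists_contDiffAt_root a
  have hcd : ∀ a, ContDiffWithinAt ℝ 2 (fun y => ψ a (H y)) s x := fun a =>
    (hψ a).comp_contDiffWithinAt x (hH x hx)
  have hlt : ∀ᶠ y in 𝓝[s] x, ∀ a b, a < b → ψ a (H y) < ψ b (H y) := by
    refine Filter.eventually_all.2 fun a => Filter.eventually_all.2 fun b => ?_
    by_cases hab : a < b
    · have : ψ a (H x) < ψ b (H x) := by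
        rw [hψx, hψx]; exact (hspec x hx).strictMono hab
      filter_upwards [(hcd a).continuousWithinAt.eventually_lt (hcd b).continuousWithinAt this]
        with y hy _ using hy
    · exact Filter.Eventually.of_forall fun y h => absurd h hab
  have hr : ∀ᶠ y in 𝓝[s] x, ∀ a,
      (Matrix.det ((ψ a (H y) : ℂ) • (1 : Matrix (Fin N) (Fin N) ℂ) - H y)).re = 0 :=
    Filter.eventually_all.2 fun a => (hH x hx).continuousWithinAt.eventually (hroot a)
  have heq : ∀ᶠ y in 𝓝[s] x, E a y = ψ a (H y) := by
    filter_upwards [hlt, hr, self_mem_nhdsWithin] with y h1 h2 hy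
    have S := hspec y hy
    have hmono : StrictMono fun a => ψ a (H y) := fun a b hab => h1 a b hab
    have hsub : ∀ a, ∃ b, E b y = ψ a (H y) := fun a => by
      have h3 := h2 a
      rw [S.re_det_sub, Finset.prod_eq_zero_iff] at h3
      obtain ⟨b, -, hb⟩ := h3
      exact ⟨b, (sub_eq_zero.1 hb).symm⟩
    choose τ hτ using hsub
    have hτm : StrictMono τ := fun a b hab => by
      rw [← S.strictMono.lt_iff_lt, hτ, hτ]
      exact hmono hab
    have hτid : τ = id := by
      have hsurj : Function.Surjective τ := Finite.surjective_of_injective hτm.injective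
      exact (StrictMono.range_inj hτm strictMono_id).1 (by simp [hsurj.range_eq])
    have := hτ a
    rwa [hτid] at this
  exact (hcd a).congr_of_eventuallyEq heq (hψx a).symm

/-- The spectral projections are `C²`, being Lagrange interpolation polynomials of `H`. -/
theorem contDiffOn_projection
    (hspec : ∀ x ∈ s, IsNondegenerateSpectralDecomposition (H x) (fun a => E a x) (fun a => P a x))
    (hH : ContDiffOn ℝ 2 H s) (a : Fin N) : ContDiffOn ℝ 2 (P a) s := by
  have hE := contDiffOn_eigenvalue hspec hH
  have key : ∀ t : Finset (Fin N), ContDiffOn ℝ 2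
      (fun x => ∑ c, (∏ b ∈ t, (E c x - E b x)) • P c x) s := by
    -- Adjoining `b` to `t` amounts to multiplication by `H - E b`.
    intro t
    induction t using Finset.induction_on with
    | empty =>
      refine (contDiffOn_const (c := (1 : Matrix (Fin N) (Fin N) ℂ))).congr fun x hx => ?_
      simpa using (hspec x hx).sum_eq_one
    | insert b t hb ih =>
      refine ((hH.sub ((hE b).smul (contDiffOn_const
        (c := (1 : Matrix (Fin N) (Fin N) ℂ))))).mul ih).congr fun x hx => ?_
      simp only [Finset.mul_sum]
      refine Finset.sum_congr rfl fun c _ => ?_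
      have hm : H x * P c x = (E c x : ℂ) • P c x := (hspec x hx).mul_proj c
      rw [Finset.prod_insert hb, mul_smul_comm, Pi.smul_apply', sub_mul (H x), hm, smul_mul_assoc,
        one_mul, Complex.coe_smul, ← sub_smul, smul_smul, mul_comm]
  have hd : ContDiffOn ℝ 2 (fun x => ∏ b ∈ Finset.univ.erase a, (E a x - E b x)) s :=
    contDiffOn_prod fun b _ => (hE a).sub (hE b)
  have hne : ∀ x ∈ s, ∏ b ∈ Finset.univ.erase a, (E a x - E b x) ≠ 0 := fun x hx =>
    Finset.prod_ne_zero_iff.2 fun b hb =>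
      sub_ne_zero.2 fun h => Finset.ne_of_mem_erase hb ((hspec x hx).strictMono.injective h.symm)
  refine ((hd.inv hne).smul (key (Finset.univ.erase a))).congr fun x hx => ?_
  rw [Pi.smul_apply', Pi.inv_apply, Finset.sum_eq_single a, smul_smul,
    inv_mul_cancel₀ (hne x hx), one_smul]
  · intro c _ hc
    rw [Finset.prod_eq_zero (Finset.mem_erase.2 ⟨hc, Finset.mem_univ c⟩) (sub_self _), zero_smul]
  · simp

end Path

/-! ### The Hilbert-Schmidt inner product -/

/-- The real part of the Hilbert-Schmidt inner product, which induces the Frobenius norm. -/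
@[reducible]
def hilbertSchmidtInnerProductSpace (N : ℕ) : InnerProductSpace ℝ (Matrix (Fin N) (Fin N) ℂ) where
  toNormedSpace := Matrix.frobeniusNormedSpace
  inner A B := (A.conjTranspose * B).trace.re
  norm_sq_eq_re_inner A := by
    rw [Matrix.trace_conjTranspose_mul_self_eq_sum, Complex.ofReal_re, RCLike.re_to_real,
      Matrix.frobenius_norm_def, ← Real.sqrt_eq_rpow, Real.sq_sqrt (by positivity)]
    norm_cast
  conj_inner_symm A B := by
    have : (A.conjTranspose * B).trace = conj (B.conjTranspose * A).trace := by
      rw [starRingEnd_apply, ← Matrix.trace_conjTranspose, Matrix.conjTranspose_mul,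
        Matrix.conjTranspose_conjTranspose]
    simp [this]
  add_left A B C := by
    rw [Matrix.conjTranspose_add, add_mul, Matrix.trace_add, Complex.add_re]
  smul_left A B r := by
    rw [Matrix.conjTranspose_smul, smul_mul_assoc, Matrix.trace_smul]
    simp

-- The Frobenius normed space comes last, so that it is the one found by instance search.
attribute [local instance] hilbertSchmidtInnerProductSpace Matrix.frobeniusNormedSpace

theorem hilbertSchmidt_inner_eq {N : ℕ} (A B : Matrix (Fin N) (Fin N) ℂ) :
    ⟪A, B⟫_ℝ = (A.conjTranspose * B).trace.re := rfl

theorem Matrix.IsHermitian.hilbertSchmidt_inner_eq {N : ℕ} {A : Matrix (Fin N) (Fin N) ℂ}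
    (hA : A.IsHermitian) (B : Matrix (Fin N) (Fin N) ℂ) : ⟪A, B⟫_ℝ = (A * B).trace.re := by
  rw [_root_.hilbertSchmidt_inner_eq, hA.eq]

/-! ### The derivative of the ground state projection -/

theorem contDiffOn_dephasingEigenvalue {N : ℕ} {E : Fin N → ℝ → ℝ}
    {γ : ℝ → ℝ} {n : WithTop ℕ∞} {s : Set ℝ}
    (hE : ∀ a, ContDiffOn ℝ n (E a) s) (hγ : ContDiffOn ℝ n γ s) (a b : Fin N) :
    ContDiffOn ℝ n (fun x => dephasingEigenvalue (fun a => E a x) (γ x) a b) s := by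
  have hof : ∀ {f : ℝ → ℝ}, ContDiffOn ℝ n f s → ContDiffOn ℝ n (fun x => (f x : ℂ)) s :=
    fun hf => Complex.ofRealCLM.contDiff.comp_contDiffOn hf
  unfold dephasingEigenvalue
  refine (contDiffOn_const.mul ((hof (hE a)).sub (hof (hE b)))).neg.sub ?_
  split_ifs
  · exact contDiffOn_const
  · exact hof hγ

section Path

variable {N : ℕ} [NeZero N] {H : ℝ → Matrix (Fin N) (Fin N) ℂ} {E : Fin N → ℝ → ℝ}
  {P : Fin N → ℝ → Matrix (Fin N) (Fin N) ℂ} {γ : ℝ → ℝ}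

theorem hasDerivWithinAt_ground
    (hP : ContDiffOn ℝ 2 (P 0) (Icc (0 : ℝ) 1)) {x : ℝ} (hx : x ∈ Icc (0 : ℝ) 1) :
    HasDerivWithinAt (P 0) (derivWithin (P 0) (Icc (0 : ℝ) 1) x) (Icc (0 : ℝ) 1) x :=
  (hP.differentiableOn (by norm_num) x hx).hasDerivWithinAt

theorem derivWithin_ground_tangent
    (hspec : ∀ x ∈ Icc (0 : ℝ) 1,
      IsNondegenerateSpectralDecomposition (H x) (fun a => E a x) (fun a => P a x))
    (hP : ContDiffOn ℝ 2 (P 0) (Icc (0 : ℝ) 1)) {x : ℝ} (hx : x ∈ Icc (0 : ℝ) 1) :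
    derivWithin (P 0) (Icc (0 : ℝ) 1) x * P 0 x + P 0 x * derivWithin (P 0) (Icc (0 : ℝ) 1) x
      = derivWithin (P 0) (Icc (0 : ℝ) 1) x := by
  have h := hasDerivWithinAt_ground hP hx
  have h2 : HasDerivWithinAt (P 0) (derivWithin (P 0) (Icc (0 : ℝ) 1) x * P 0 x
      + P 0 x * derivWithin (P 0) (Icc (0 : ℝ) 1) x) (Icc (0 : ℝ) 1) x :=
    (HasDerivWithinAt.mul h h).congr (fun y hy => ((hspec y hy).idempotent 0).symm)
      ((hspec x hx).idempotent 0).symm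
  exact (uniqueDiffOn_Icc zero_lt_one x hx).eq_deriv _ h2 h

theorem isHermitian_derivWithin_ground
    (hspec : ∀ x ∈ Icc (0 : ℝ) 1,
      IsNondegenerateSpectralDecomposition (H x) (fun a => E a x) (fun a => P a x))
    (hP : ContDiffOn ℝ 2 (P 0) (Icc (0 : ℝ) 1)) {x : ℝ} (hx : x ∈ Icc (0 : ℝ) 1) :
    (derivWithin (P 0) (Icc (0 : ℝ) 1) x).IsHermitian := by
  have h := hasDerivWithinAt_ground hP hx
  have h2 : HasDerivWithinAt (P 0) (star (derivWithin (P 0) (Icc (0 : ℝ) 1) x))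
      (Icc (0 : ℝ) 1) x :=
    (HasDerivWithinAt.star h).congr (fun y hy => ((hspec y hy).isHermitian 0).symm)
      ((hspec x hx).isHermitian 0).symm
  exact (uniqueDiffOn_Icc zero_lt_one x hx).eq_deriv _ h2 h

theorem tunnelingMass_nonneg
    (hspec : ∀ x ∈ Icc (0 : ℝ) 1,
      IsNondegenerateSpectralDecomposition (H x) (fun a => E a x) (fun a => P a x))
    (hP : ContDiffOn ℝ 2 (P 0) (Icc (0 : ℝ) 1)) {x : ℝ} (hx : x ∈ Icc (0 : ℝ) 1)
    (hγ : 0 ≤ γ x) : 0 ≤ tunnelingMass E P γ x :=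
  Finset.sum_nonneg fun a _ => div_nonneg (mul_nonneg hγ
    ((hspec x hx).re_trace_proj_mul_sq_nonneg (isHermitian_derivWithin_ground hspec hP hx) a))
    (by positivity)

/-- The overlap of the observable corrector with `P₀'` is, up to the factor `-2`, the mass. -/
theorem re_trace_groundCorrector_mul_derivWithin
    (hspec : ∀ x ∈ Icc (0 : ℝ) 1,
      IsNondegenerateSpectralDecomposition (H x) (fun a => E a x) (fun a => P a x))
    (hP : ContDiffOn ℝ 2 (P 0) (Icc (0 : ℝ) 1)) {x : ℝ} (hx : x ∈ Icc (0 : ℝ) 1) :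
    (groundCorrector (fun a => P a x)
        (fun a => (dephasingEigenvalue (fun a => E a x) (γ x) 0 a)⁻¹)
        (derivWithin (P 0) (Icc (0 : ℝ) 1) x) * derivWithin (P 0) (Icc (0 : ℝ) 1) x).trace.re
      = -2 * tunnelingMass E P γ x := by
  rw [(hspec x hx).re_trace_groundCorrector_mul (derivWithin_ground_tangent hspec hP hx),
    tunnelingMass, Finset.mul_sum]
  refine Finset.sum_congr rfl fun a ha => ?_
  rw [inv_dephasingEigenvalue_re _ _ (Finset.ne_of_mem_erase ha).symm]
  ring

theorem contDiffOn_groundCorrector {n : WithTop ℕ∞} {s : Set ℝ}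
    (hP : ∀ a, ContDiffOn ℝ n (P a) s) {c : Fin N → ℝ → ℂ}
    (hc : ∀ a ≠ 0, ContDiffOn ℝ n (c a) s) {D : ℝ → Matrix (Fin N) (Fin N) ℂ}
    (hD : ContDiffOn ℝ n D s) :
    ContDiffOn ℝ n (fun x => groundCorrector (fun a => P a x) (fun a => c a x) (D x)) s := by
  refine ContDiffOn.sum fun a ha => ?_
  have ha : a ≠ 0 := Finset.ne_of_mem_erase ha
  exact ((hc a ha).smul (((hP a).mul hD).mul (hP 0))).add
    ((Complex.conjCLE.contDiff.comp_contDiffOn (hc a ha)).smul (((hP 0).mul hD).mul (hP a)))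

end Path

section Schedule

/-- A path along the schedule of the form `q' • Z(q)` with `Z` of class `C¹` is of class `C¹`. -/
theorem contDiffOn_velocity_smul_comp {V : Type*} [NormedAddCommGroup V] [NormedSpace ℝ V]
    {q : ℝ → ℝ} (hq : ContDiffOn ℝ 2 q (Icc (0 : ℝ) 1))
    (hmaps : MapsTo q (Icc (0 : ℝ) 1) (Icc (0 : ℝ) 1)) {Z : ℝ → V}
    (hZ : ContDiffOn ℝ 1 Z (Icc (0 : ℝ) 1)) :
    ContDiffOn ℝ 1 (fun s => derivWithin q (Icc (0 : ℝ) 1) s • Z (q s)) (Icc (0 : ℝ) 1) :=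
  (hq.derivWithin (uniqueDiffOn_Icc zero_lt_one) (by norm_num)).smul
    (hZ.comp (hq.of_le (by norm_num)) hmaps)

variable {N : ℕ} [NeZero N] {H : ℝ → Matrix (Fin N) (Fin N) ℂ} {E : Fin N → ℝ → ℝ}
  {P : Fin N → ℝ → Matrix (Fin N) (Fin N) ℂ} {γ q : ℝ → ℝ}

/-- The general expansion applied to `p = P₀(q)` and the correctors `q' • Z(q)`, where `Z` is a
corrector for `P₀'` and thus independent of the schedule. -/
theorem exists_abs_tunnelingProbability_sub_le
    (hspec : ∀ x ∈ Icc (0 : ℝ) 1,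
      IsNondegenerateSpectralDecomposition (H x) (fun a => E a x) (fun a => P a x))
    (hH : ContDiffOn ℝ 2 H (Icc (0 : ℝ) 1)) (hγ : ContDiffOn ℝ 1 γ (Icc (0 : ℝ) 1))
    (hγ0 : ∀ x ∈ Icc (0 : ℝ) 1, 0 ≤ γ x) (hq : ContDiffOn ℝ 2 q (Icc (0 : ℝ) 1))
    (hmaps : MapsTo q (Icc (0 : ℝ) 1) (Icc (0 : ℝ) 1)) :
    ∃ C : ℝ, ∀ ε : ℝ, 0 < ε →
      ∀ ρ : ℝ → Matrix (Fin N) (Fin N) ℂ, IsDephasingEvolution H P γ q ε ρ →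
        |tunnelingProbability P q ρ
            - 2 * ε * ∫ u in (0 : ℝ)..1,
                tunnelingMass E P γ (q u) * derivWithin q (Icc (0 : ℝ) 1) u ^ 2|
          ≤ C * ε ^ 2 := by
  have hud : UniqueDiffOn ℝ (Icc (0 : ℝ) 1) := uniqueDiffOn_Icc zero_lt_one
  have hP2 := contDiffOn_projection hspec hH
  have hP1 : ∀ a, ContDiffOn ℝ 1 (P a) (Icc (0 : ℝ) 1) := fun a => (hP2 a).of_le (by norm_num)
  have hE1 : ∀ a, ContDiffOn ℝ 1 (E a) (Icc (0 : ℝ) 1) := fun a =>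
    (contDiffOn_eigenvalue hspec hH a).of_le (by norm_num)
  set D : ℝ → Matrix (Fin N) (Fin N) ℂ := derivWithin (P 0) (Icc (0 : ℝ) 1) with hDdef
  have hD1 : ContDiffOn ℝ 1 D (Icc (0 : ℝ) 1) := (hP2 0).derivWithin hud (by norm_num)
  have htan : ∀ x ∈ Icc (0 : ℝ) 1, D x * P 0 x + P 0 x * D x = D x := fun x hx =>
    derivWithin_ground_tangent hspec (hP2 0) hx
  have hDh : ∀ x ∈ Icc (0 : ℝ) 1, (D x).IsHermitian := fun x hx =>
    isHermitian_derivWithin_ground hspec (hP2 0) hx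
  set lam : Fin N → Fin N → ℝ → ℂ := fun a b x =>
    dephasingEigenvalue (fun a => E a x) (γ x) a b with hlam
  have hinv : ∀ a b, a ≠ b → ContDiffOn ℝ 1 (fun x => (lam a b x)⁻¹) (Icc (0 : ℝ) 1) :=
    fun a b hab => (contDiffOn_dephasingEigenvalue hE1 hγ a b).inv fun x hx =>
      dephasingEigenvalue_ne_zero (hspec x hx).strictMono _ hab
  set ZY : ℝ → Matrix (Fin N) (Fin N) ℂ := fun x =>
    groundCorrector (fun a => P a x) (fun a => (lam a 0 x)⁻¹) (D x) with hZY
  set ZX : ℝ → Matrix (Fin N) (Fin N) ℂ := fun x =>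
    groundCorrector (fun a => P a x) (fun a => (lam 0 a x)⁻¹) (D x) with hZX
  have hZY1 : ContDiffOn ℝ 1 ZY (Icc (0 : ℝ) 1) :=
    contDiffOn_groundCorrector hP1 (fun a ha => hinv a 0 ha) hD1
  have hZX1 : ContDiffOn ℝ 1 ZX (Icc (0 : ℝ) 1) :=
    contDiffOn_groundCorrector hP1 (fun a ha => hinv 0 a ha.symm) hD1
  have hZXh : ∀ x ∈ Icc (0 : ℝ) 1, (ZX x).IsHermitian := fun x hx =>
    (hspec x hx).isHermitian_groundCorrector (hDh x hx) _
  set v : ℝ → ℝ := derivWithin q (Icc (0 : ℝ) 1) with hv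
  have hY := contDiffOn_velocity_smul_comp hq hmaps hZY1
  have hX := contDiffOn_velocity_smul_comp hq hmaps hZX1
  have hp : ∀ s ∈ Icc (0 : ℝ) 1, HasDerivWithinAt (fun s => P 0 (q s)) (v s • D (q s))
      (Icc (0 : ℝ) 1) s := fun s hs =>
    HasDerivWithinAt.scomp s (hasDerivWithinAt_ground (hP2 0) (hmaps hs))
      (hq.differentiableOn (by norm_num) s hs).hasDerivWithinAt hmaps
  obtain ⟨C, hC⟩ := exists_abs_overlap_sub_le
    (V := Matrix (Fin N) (Fin N) ℂ)
    (L := fun s => dephasingLinearMap (H (q s)) (fun a => P a (q s)) (γ (q s)))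
    (p := fun s => P 0 (q s)) (p' := fun s => v s • D (q s))
    (X := fun s => v s • ZX (q s)) (Y := fun s => v s • ZY (q s))
    (X' := derivWithin (fun s => v s • ZX (q s)) (Icc (0 : ℝ) 1))
    (Y' := derivWithin (fun s => v s • ZY (q s)) (Icc (0 : ℝ) 1))
    (fun s hs A => (hspec _ (hmaps hs)).re_trace_conjTranspose_mul_lindbladian_nonpos
      (hγ0 _ (hmaps hs)) A)
    hp (contDiffOn_velocity_smul_comp hq hmaps hD1).continuousOn
    (fun s hs => (hspec _ (hmaps hs)).lindbladian_proj _ 0)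
    (fun s hs A => by
      rw [((hspec _ (hmaps hs)).isHermitian 0).hilbertSchmidt_inner_eq]
      exact congrArg Complex.re ((hspec _ (hmaps hs)).trace_proj_mul_lindbladian _ A 0))
    (fun s hs => (hY.differentiableOn (by norm_num) s hs).hasDerivWithinAt)
    (hY.continuousOn_derivWithin hud le_rfl)
    (fun s hs => by
      rw [map_smul]
      exact congrArg (v s • ·)
        ((hspec _ (hmaps hs)).lindbladian_groundCorrector (htan _ (hmaps hs)) _))
    (fun s hs => (hX.differentiableOn (by norm_num) s hs).hasDerivWithinAt)
    (hX.continuousOn_derivWithin hud le_rfl)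
    (fun s hs A => by
      rw [real_inner_smul_left, real_inner_smul_left, (hZXh _ (hmaps hs)).hilbertSchmidt_inner_eq,
        (hDh _ (hmaps hs)).hilbertSchmidt_inner_eq]
      exact congrArg (fun z : ℂ => v s * z.re)
        ((hspec _ (hmaps hs)).trace_groundCorrector_mul_lindbladian (htan _ (hmaps hs)) _ A))
    (fun s hs => by
      rw [real_inner_smul_left, (hZXh _ (hmaps hs)).hilbertSchmidt_inner_eq]
      have := (hspec _ (hmaps hs)).trace_groundCorrector_mul_ground
        (D := D (q s)) (fun a => (lam 0 a (q s))⁻¹)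
      exact (congrArg (fun z : ℂ => v s * z.re) this).trans (by simp))
  refine ⟨C, fun ε hε ρ hρ => ?_⟩
  have h := hC ε hε ρ hρ.initial fun s hs => hρ.master s hs
  have i0 : q 0 ∈ Icc (0 : ℝ) 1 := hmaps (left_mem_Icc.2 zero_le_one)
  have i1 : q 1 ∈ Icc (0 : ℝ) 1 := hmaps (right_mem_Icc.2 zero_le_one)
  have e0 : ⟪P 0 (q 0), P 0 (q 0)⟫_ℝ = 1 := by
    have h1 : P 0 (q 0) * P 0 (q 0) = P 0 (q 0) := (hspec _ i0).idempotent 0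
    have h2 : (P 0 (q 0)).trace = 1 := (hspec _ i0).trace_eq_one 0
    rw [((hspec _ i0).isHermitian 0).hilbertSchmidt_inner_eq, h1, h2, Complex.one_re]
  have e1 : ⟪P 0 (q 1), ρ 1⟫_ℝ = (P 0 (q 1) * ρ 1).trace.re :=
    ((hspec _ i1).isHermitian 0).hilbertSchmidt_inner_eq _
  have e2 : ∫ u in (0 : ℝ)..1, ⟪v u • ZX (q u), v u • D (q u)⟫_ℝ
      = -2 * ∫ u in (0 : ℝ)..1, tunnelingMass E P γ (q u) * v u ^ 2 := by
    rw [← intervalIntegral.integral_const_mul]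
    refine intervalIntegral.integral_congr fun u hu => ?_
    rw [uIcc_of_le zero_le_one] at hu
    have := re_trace_groundCorrector_mul_derivWithin (γ := γ) hspec (hP2 0) (hmaps hu)
    simp only [real_inner_smul_left, real_inner_smul_right]
    rw [(hZXh _ (hmaps hu)).hilbertSchmidt_inner_eq]
    linear_combination v u * v u * this
  rw [e0, e1, e2] at h
  rw [← abs_neg] at h
  refine le_of_eq_of_le (congrArg _ ?_) h
  rw [tunnelingProbability]
  ring

end Schedule

end

theorem theorem1 {N : ℕ} [NeZero N] (H : ℝ → Matrix (Fin N) (Fin N) ℂ)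
    (E : Fin N → ℝ → ℝ) (P : Fin N → ℝ → Matrix (Fin N) (Fin N) ℂ) (γ : ℝ → ℝ)
    (hspec : ∀ x ∈ Icc (0 : ℝ) 1,
      IsNondegenerateSpectralDecomposition (H x) (fun a => E a x) (fun a => P a x))
    (hH : ∀ i j, ContDiffOn ℝ 2 (fun x => H x i j) (Icc (0 : ℝ) 1))
    (hγ : ContDiffOn ℝ 1 γ (Icc (0 : ℝ) 1))
    (hγ0 : ∀ x ∈ Icc (0 : ℝ) 1, 0 ≤ γ x) :
    (∀ x ∈ Icc (0 : ℝ) 1, 0 ≤ tunnelingMass E P γ x) ∧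
    ∀ q : ℝ → ℝ, ContDiffOn ℝ 2 q (Icc (0 : ℝ) 1) →
      MapsTo q (Icc (0 : ℝ) 1) (Icc (0 : ℝ) 1) →
      ∃ C : ℝ, ∀ ε : ℝ, 0 < ε →
        ∀ ρ : ℝ → Matrix (Fin N) (Fin N) ℂ, IsDephasingEvolution H P γ q ε ρ →
          |tunnelingProbability P q ρ
              - 2 * ε * ∫ u in (0 : ℝ)..1,
                  tunnelingMass E P γ (q u) * derivWithin q (Icc (0 : ℝ) 1) u ^ 2|
            ≤ C * ε ^ 2 := by
  have hH' := ContDiffOn.matrix_of_entries hH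
  exact ⟨fun x hx => tunnelingMass_nonneg hspec (contDiffOn_projection hspec hH' 0) hx (hγ0 x hx),
    fun q hq hmaps => exists_abs_tunnelingProbability_sub_le hspec hH' hγ hγ0 hq hmaps⟩
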